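/- Let $R$ be a commutative ring with identity and let $n\ge 1$ be an integer such that every matrix in the ring $\mathbb M_n(R)$ of $n\times n$ matrices over $R$ is a sum of three idempotent matrices in $\mathbb M_n(R)$. Let $J(R)$ denote the Jacobson radical of $R$. Then $J(R)$ is nil (every element of $J(R)$ is nilpotent), and $R/J(R)$ satisfies the identity $x^3=x$. If in addition $R$ is indecomposable (that is, $R$ is nonzero and is not isomorphic to a direct product of two nonzero rings), then $R$ is isomorphic to $\mathbb Z_2$, $\mathbb Z_3$ or $\mathbb Z_4$, where $\mathbb Z_m$ denotes the ring of integers modulo $m$. -/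

import Mathlib

universe u

/-- An element of a ring is a sum of three idempotents. No relation (such as commuting or
distinctness) between the idempotents is required. -/
def IsSumOfThreeIdempotents {S : Type u} [Ring S] (a : S) : Prop :=
  ∃ e f g : S, IsIdempotentElem e ∧ IsIdempotentElem f ∧ IsIdempotentElem g ∧ a = e + f + g

/-- A ring is indecomposable if it is nonzero and is not isomorphic to a direct product of two
nonzero rings. (The factors are quotients of `R`, so one universe suffices.) -/
structure IsIndecomposableRing (R : Type u) [Ring R] : Prop where
  nontrivial : Nontrivial R
  not_prod : ∀ (A B : Type u) [Ring A] [Ring B] [Nontrivial A] [Nontrivial B],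
    ¬ Nonempty (R ≃+* A × B)

/-!
Suppose that all `n × n` matrices over `R` are sums of three idempotents. Such decompositions are
carried along by ring homomorphisms out of `R`, so `R` can be tested on its homomorphic images.

* Over a local ring an idempotent matrix has a natural number as its trace, since it projects
  onto a free module. Comparing traces in a decomposition of `diag(a, 0, …, 0)` shows that every
  element of `R` becomes a natural number in every local ring receiving a map from `R`
  (`exists_map_eq_natCast`).
* If `4 = e + f + g` with idempotents `e, f, g` of any ring, then `60 * e = 0`
  (`sixty_mul_eq_zero_of_four_eq_add`). Hence `240 = 0` in `R`, and `R` has no homomorphism to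
  `ℤ/8`, because there an idempotent matrix killed by `60` is even, hence zero.
* A field of characteristic `5` cannot receive a map from `R` (`five_ne_zero_of_ringHom`). For
  idempotents `f, g`, the elements `c = f + g - 1` and `d = f - g` anticommute and
  `c² + d² = 1`, so `d` exchanges the eigenspaces of `c` for `μ` and `-μ` when `μ² ≠ 1`.
  With `μ = 3 = -2` this forces the scalar matrix `4` to have even size, and in even size it
  prevents `4 + diag(2, 0, …, 0)` from being a sum of three idempotents: a rank one perturbation
  changes eigenspace dimensions by at most one, which together with the trace of `c` forces each
  of `e, f, g` to have half the full rank, and then the traces do not match.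

Consequently every residue field at a prime of `R` receives from `R` only natural numbers and
satisfies `6 = 0`, so `x ^ 3 - x` lies in every prime, that is, `x ^ 3 - x` is nilpotent
(`isNilpotent_pow_three_sub`). This gives the two statements on the Jacobson radical. If `R` is
indecomposable, lifting the idempotent `x²` modulo the nilradical shows that `R` is local; then
`R` is `ℤ/m` for some `m` dividing `240`, and the above leaves only `m = 2, 3, 4`.
-/

/-! ### Sums of three idempotents under ring homomorphisms -/

universe v

theorem IsSumOfThreeIdempotents.map {S : Type u} {T : Type v} [Ring S] [Ring T] (φ : S →+* T)
    {a : S} (ha : IsSumOfThreeIdempotents a) : IsSumOfThreeIdempotents (φ a) := by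
  obtain ⟨e, f, g, he, hf, hg, rfl⟩ := ha
  exact ⟨φ e, φ f, φ g, he.map φ, hf.map φ, hg.map φ, by simp⟩

/-! ### The scalar four -/

/-- Eliminating `g` gives `e * f + f * e = 6 * e + 6 * f - 12`. Multiplying this by `e` or `f` on
one side or on both sides yields two values of `e * f * e` and of `f * e * f`, and comparing them
gives `180 * e = 240`. -/
theorem sixty_mul_eq_zero_of_four_eq_add {S : Type u} [Ring S] {e f g : S}
    (he : IsIdempotentElem e) (hf : IsIdempotentElem f) (hg : IsIdempotentElem g)
    (h : 4 = e + f + g) : 60 * e = 0 := by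
  have he' : e * e = e := he
  have hf' : f * f = f := hf
  have hg' : g = 4 • 1 - e - f := by
    have h4 : (4 : S) = 4 • 1 := by simp
    rw [← h4, h]; abel
  have key : e * f + f * e = 6 • e + 6 • f - 12 • 1 := by
    have h2 : (4 • 1 - e - f) * (4 • 1 - e - f) = 4 • 1 - e - f := by rw [← hg']; exact hg
    linear_combination (norm := noncomm_ring) h2 - he' - hf'
  have h1 : e * f * e = 5 • (e * f) - 6 • e := by
    linear_combination (norm := noncomm_ring) e * key - he' * f + 6 • he'
  have h2 : e * f * e = 5 • (f * e) - 6 • e := by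
    linear_combination (norm := noncomm_ring) key * e - f * he' + 6 • he'
  have h3 : f * e * f = 5 • (e * f) - 6 • f := by
    linear_combination (norm := noncomm_ring) key * f - e * hf' + 6 • hf'
  have h4 : 4 • (e * f * e) = 6 • e := by
    linear_combination (norm := noncomm_ring)
      (-1 : ℤ) • (e * key * e) + he' * f * e + e * f * he' - 6 • he' * e + 6 • he'
  have h5 : 4 • (f * e * f) = 6 • f := by
    linear_combination (norm := noncomm_ring)
      (-1 : ℤ) • (f * key * f) + hf' * e * f + f * e * hf' - 6 • hf' * f + 6 • hf'
  have h6 : 180 • e = 240 • 1 := by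
    linear_combination (norm := noncomm_ring)
      (-20 : ℤ) • key - 2 • h4 + 12 • h1 - 4 • h2 + 4 • h5 - 16 • h3
  have h7 : 60 • e = 0 := by
    linear_combination (norm := noncomm_ring) 180 • he' - h6 * e
  simpa using h7

/-! ### Pairs of idempotents -/

theorem anticommute_of_isIdempotentElem {S : Type u} [Ring S] {f g : S} (hf : IsIdempotentElem f)
    (hg : IsIdempotentElem g) : (f + g - 1) * (f - g) = -((f - g) * (f + g - 1)) := by
  have hf' : f * f = f := hf
  have hg' : g * g = g := hg
  linear_combination (norm := noncomm_ring) 2 • hf' - 2 • hg'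

theorem add_sub_one_sq_add_sub_sq {S : Type u} [Ring S] {f g : S} (hf : IsIdempotentElem f)
    (hg : IsIdempotentElem g) : (f + g - 1) * (f + g - 1) + (f - g) * (f - g) = 1 := by
  have hf' : f * f = f := hf
  have hg' : g * g = g := hg
  linear_combination (norm := noncomm_ring) 2 • hf' + 2 • hg'

section Field

open Module LinearMap

variable {K : Type u} [Field K] {V : Type v} [AddCommGroup V] [Module K V] [FiniteDimensional K V]

theorem finrank_range_add_le (x y : End K V) :
    finrank K (range (x + y)) ≤ finrank K (range x) + finrank K (range y) :=
  (Submodule.finrank_mono (LinearMap.range_add_le x y)).trans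
    (Submodule.finrank_add_le_finrank_add_finrank _ _)

/-- The difference `f - g` maps the first eigenspace into the second, and is injective there since
its square acts as `1 - μ ^ 2`. -/
theorem finrank_ker_add_sub_one_le {f g : End K V} (hf : IsIdempotentElem f)
    (hg : IsIdempotentElem g) {μ : K} (hμ : μ ^ 2 ≠ 1) :
    finrank K (ker (f + g - 1 - algebraMap K _ μ)) ≤
      finrank K (ker (f + g - 1 - algebraMap K _ (-μ))) := by
  have hcd := anticommute_of_isIdempotentElem hf hg
  have hcc := add_sub_one_sq_add_sub_sq hf hg
  generalize f + g - 1 = c at *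
  generalize f - g = d at *
  have hmem {ν : K} {v : V} : v ∈ ker (c - algebraMap K _ ν) ↔ c v = ν • v := by
    simp [sub_eq_zero]
  have hmaps : ∀ v ∈ ker (c - algebraMap K _ μ), d v ∈ ker (c - algebraMap K _ (-μ)) := by
    intro v hv
    rw [hmem] at hv ⊢
    have := LinearMap.congr_fun hcd v
    simp only [Module.End.mul_apply, LinearMap.neg_apply, hv, map_smul] at this
    rw [this, neg_smul]
  refine LinearMap.finrank_le_finrank_of_injective (f := d.restrict hmaps) ?_
  rw [← LinearMap.ker_eq_bot, LinearMap.ker_eq_bot']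
  rintro ⟨v, hv⟩ hdv
  have hdv' : d v = 0 := congrArg Subtype.val hdv
  rw [hmem] at hv
  have := LinearMap.congr_fun hcc v
  simp only [Module.End.mul_apply, LinearMap.add_apply, hdv', hv, map_smul, map_zero, add_zero,
    Module.End.one_apply, smul_smul] at this
  ext
  have h0 : (μ ^ 2 - 1) • v = 0 := by rw [sub_smul, pow_two, this, one_smul, sub_self]
  exact (smul_eq_zero.mp h0).resolve_left (sub_ne_zero.mpr hμ)

theorem finrank_ker_add_sub_one {f g : End K V} (hf : IsIdempotentElem f)
    (hg : IsIdempotentElem g) {μ : K} (hμ : μ ^ 2 ≠ 1) :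
    finrank K (ker (f + g - 1 - algebraMap K _ μ)) =
      finrank K (ker (f + g - 1 - algebraMap K _ (-μ))) := by
  refine (finrank_ker_add_sub_one_le hf hg hμ).antisymm ?_
  have h := finrank_ker_add_sub_one_le hf hg (μ := -μ) (by rwa [neg_sq])
  rwa [neg_neg] at h

theorem finrank_range_one_sub {e : End K V} (he : IsIdempotentElem e) :
    finrank K (range (1 - e)) + finrank K (range e) = finrank K V := by
  have h : range (1 - e) = ker e := by
    have := IsIdempotentElem.range_eq_ker_one_sub he.one_sub
    simpa using this
  rw [h, add_comm, finrank_range_add_finrank_ker]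

/-- In characteristic `5`, if the eigenspaces of `c = f + g - 1` for `3` and `-3` fill the space,
then `c * c = 9`, so that `d = f - g` satisfies `d * d = 1 - 9 = 2`. Thus `d` is invertible and
conjugates `c` to `-c`. -/
theorem trace_eq_zero_of_finrank_ker (h5 : (5 : K) = 0) {f g : End K V} (hf : IsIdempotentElem f)
    (hg : IsIdempotentElem g)
    (h : finrank K V ≤ finrank K (ker (f + g - 1 - algebraMap K _ 3)) +
      finrank K (ker (f + g - 1 - algebraMap K _ (-3)))) :
    LinearMap.trace K V (f + g - 1) = 0 := by
  have hcd := anticommute_of_isIdempotentElem hf hg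
  have hcc := add_sub_one_sq_add_sub_sq hf hg
  generalize f + g - 1 = c at *
  generalize f - g = d at *
  have h1 : (1 : K) ≠ 0 := one_ne_zero
  have hmem {ν : K} {v : V} : v ∈ ker (c - algebraMap K _ ν) ↔ c v = ν • v := by
    simp [sub_eq_zero]
  have hdisj : Disjoint (ker (c - algebraMap K _ 3)) (ker (c - algebraMap K _ (-3))) := by
    rw [Submodule.disjoint_def]
    intro v hv hv'
    rw [hmem] at hv hv'
    have h0 : (3 - -3 : K) • v = 0 := by rw [sub_smul, ← hv, ← hv', sub_self]
    refine (smul_eq_zero.mp h0).resolve_left fun h6 => h1 ?_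
    linear_combination h6 - h5
  have htop : ker (c - algebraMap K _ 3) ⊔ ker (c - algebraMap K _ (-3)) = ⊤ := by
    apply Submodule.eq_top_of_finrank_eq
    have := Submodule.finrank_sup_add_finrank_inf_eq (ker (c - algebraMap K _ 3))
      (ker (c - algebraMap K _ (-3)))
    rw [hdisj.eq_bot, finrank_bot] at this
    have := Submodule.finrank_le (ker (c - algebraMap K _ 3) ⊔ ker (c - algebraMap K _ (-3)))
    omega
  have hc : c * c = algebraMap K _ 9 := by
    rw [← sub_eq_zero, ← LinearMap.ker_eq_top, eq_top_iff, ← htop, sup_le_iff]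
    constructor <;> intro v hv <;> rw [hmem] at hv <;>
      simp only [mem_ker, LinearMap.sub_apply, Module.End.mul_apply, hv, map_smul, smul_smul,
        Module.algebraMap_end_apply, ← sub_smul] <;> norm_num
  have hd : d * d = algebraMap K _ 2 := by
    have h8 : (2 : K) = 1 - 9 := by linear_combination 2 * h5
    rw [h8, map_sub, map_one, ← hc, ← hcc]
    abel
  have ht : LinearMap.trace K V (c * d * d) = -LinearMap.trace K V (c * d * d) := by
    conv_lhs => rw [LinearMap.trace_mul_comm, ← mul_assoc, ← neg_neg (d * c), ← hcd, neg_mul,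
      map_neg]
  rw [mul_assoc, hd, ← Algebra.commutes, ← Algebra.smul_def, map_smul, smul_eq_mul] at ht
  linear_combination -ht + LinearMap.trace K V c * h5

/-- In characteristic `5`, in a decomposition of `4` plus an endomorphism `b` of rank at most one
and trace `2` on a space of even dimension, each idempotent has half the full rank. Indeed the
kernels of `f + g - 1 - 3 = b - e` and `f + g - 1 + 3 = b + (1 - e)` have the same dimension, so
the rank of `e` is at most one away from `k`. If it is not `k`, then these kernels fill the space
and `f + g - 1 = 3 + b - e` has trace zero, which contradicts the value of `trace b`. -/
theorem finrank_range_eq_of_add_eq (h5 : (5 : K) = 0) {k : ℕ} (hV : finrank K V = 2 * k)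
    {b e f g : End K V} (hb : finrank K (range b) ≤ 1) (htr : LinearMap.trace K V b = 2)
    (he : IsIdempotentElem e) (hf : IsIdempotentElem f) (hg : IsIdempotentElem g)
    (h : algebraMap K _ 4 + b = e + f + g) : finrank K (range e) = k := by
  have htre : LinearMap.trace K V e = finrank K (range e) := he.isProj_range.trace
  have h1 := finrank_range_one_sub he
  have hc : f + g - 1 = algebraMap K _ 3 + b - e := by
    rw [show (3 : K) = 4 - 1 by norm_num, map_sub, map_one, sub_add_eq_add_sub, h]
    abel
  have h3 := finrank_ker_add_sub_one hf hg (μ := 3)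
    (fun h => one_ne_zero (by linear_combination 2 * h - 3 * h5 : (1 : K) = 0))
  have ht := trace_eq_zero_of_finrank_ker h5 hf hg
  rw [hc] at h3 ht
  have ha : algebraMap K (End K V) 3 + b - e - algebraMap K (End K V) 3 = b - e := by abel
  have ha' : algebraMap K (End K V) 3 + b - e - algebraMap K (End K V) (-3) = b + (1 - e) := by
    have h6 : algebraMap K (End K V) 3 - algebraMap K (End K V) (-3) = 1 := by
      rw [← map_sub, show (3 - -3 : K) = 1 by linear_combination h5, map_one]
    rw [← h6]; abel
  rw [ha, ha'] at h3 ht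
  have hr := finrank_range_add_finrank_ker (b - e)
  have hr' := finrank_range_add_finrank_ker (b + (1 - e))
  have i1 := finrank_range_add_le b (-e)
  have i2 := finrank_range_add_le b (1 - e)
  have i3 := finrank_range_add_le (b - e) (-b)
  have i4 := finrank_range_add_le (b + (1 - e)) (-b)
  rw [← sub_eq_add_neg, LinearMap.range_neg] at i1
  rw [show b - e + -b = -e by abel, LinearMap.range_neg, LinearMap.range_neg] at i3
  rw [show b + (1 - e) + -b = 1 - e by abel, LinearMap.range_neg] at i4
  by_contra hne
  have htc := ht (by omega)
  rw [map_sub, map_add, htr, htre, Module.algebraMap_end_eq_smul_id, map_smul,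
    LinearMap.trace_id, hV, smul_eq_mul] at htc
  obtain hp | hp : finrank K (range e) = k + 1 ∨ finrank K (range e) + 1 = k := by omega
  · rw [hp] at htc
    push_cast at htc
    exact one_ne_zero (by linear_combination htc - k * h5 : (1 : K) = 0)
  · rw [← hp] at htc
    push_cast at htc
    exact one_ne_zero (by
      linear_combination 2 * htc - (2 * (finrank K (range e) : K) + 3) * h5 : (1 : K) = 0)

/-- The kernels of `f + g - 1 - 3 = -e` and `f + g - 1 + 3 = 1 - e` have the same dimension. -/
theorem even_finrank_of_four_eq_add (h5 : (5 : K) = 0) {e f g : End K V}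
    (he : IsIdempotentElem e) (hf : IsIdempotentElem f) (hg : IsIdempotentElem g)
    (h : algebraMap K _ 4 = e + f + g) : Even (finrank K V) := by
  have h1 := finrank_range_one_sub he
  have hc : f + g - 1 = algebraMap K _ 3 - e := by
    rw [show (3 : K) = 4 - 1 by norm_num, map_sub, map_one, h]
    abel
  have h3 := finrank_ker_add_sub_one hf hg (μ := 3)
    (fun h => one_ne_zero (by linear_combination 2 * h - 3 * h5 : (1 : K) = 0))
  rw [hc] at h3
  have ha : algebraMap K (End K V) 3 - e - algebraMap K (End K V) 3 = -e := by abel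
  have ha' : algebraMap K (End K V) 3 - e - algebraMap K (End K V) (-3) = 1 - e := by
    have h6 : algebraMap K (End K V) 3 - algebraMap K (End K V) (-3) = 1 := by
      rw [← map_sub, show (3 - -3 : K) = 1 by linear_combination h5, map_one]
    rw [← h6]; abel
  rw [ha, ha'] at h3
  have hr := finrank_range_add_finrank_ker (-e)
  have hr' := finrank_range_add_finrank_ker (1 - e)
  rw [LinearMap.range_neg] at hr
  exact ⟨finrank K (range e), by omega⟩

theorem add_ne_four_add_of_even (h5 : (5 : K) = 0) (hV : Even (finrank K V))
    {b : End K V} (hb : finrank K (range b) ≤ 1) (htr : LinearMap.trace K V b = 2) :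
    ¬ IsSumOfThreeIdempotents (algebraMap K (End K V) 4 + b) := by
  rintro ⟨e, f, g, he, hf, hg, h⟩
  obtain ⟨k, hk⟩ := even_iff_exists_two_mul.mp hV
  have hre := finrank_range_eq_of_add_eq h5 hk hb htr he hf hg h
  have hrf := finrank_range_eq_of_add_eq h5 hk hb htr hf he hg (h.trans (by abel))
  have hrg := finrank_range_eq_of_add_eq h5 hk hb htr hg he hf (h.trans (by abel))
  have ht := congrArg (LinearMap.trace K V) h
  rw [map_add, map_add, map_add, htr, he.isProj_range.trace, hf.isProj_range.trace,
    hg.isProj_range.trace, hre, hrf, hrg, Module.algebraMap_end_eq_smul_id, map_smul,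
    LinearMap.trace_id, hk, smul_eq_mul] at ht
  push_cast at ht
  exact one_ne_zero (by linear_combination (1 + 2 * k : K) * h5 - 2 * ht : (1 : K) = 0)

end Field

/-! ### Images of a ring all of whose matrices are sums of three idempotents -/

section Image

open Matrix

theorem projective_range {S : Type u} [CommRing S] {M : Type v} [AddCommGroup M] [Module S M]
    [Module.Projective S M] {e : Module.End S M} (he : IsIdempotentElem e) :
    Module.Projective S (LinearMap.range e) :=
  Module.Projective.of_split (LinearMap.range e).subtype (LinearMap.rangeRestrict e) <| by
    ext x
    exact (LinearMap.IsIdempotentElem.mem_range_iff he).mp x.2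

/-- The trace is the rank of the range, a projective module and hence free over a local ring. -/
theorem exists_trace_eq_natCast {S : Type u} [CommRing S] [IsLocalRing S] {n : ℕ}
    {e : Matrix (Fin n) (Fin n) S} (he : IsIdempotentElem e) : ∃ k : ℕ, e.trace = k := by
  have he' : IsIdempotentElem (Matrix.toLin' e) := he.map (Matrix.toLinAlgEquiv' (R := S))
  have : Module.Projective S (LinearMap.range (Matrix.toLin' e)) := projective_range he'
  have hker : LinearMap.ker (Matrix.toLin' e) = LinearMap.range (1 - Matrix.toLin' e) := by
    simpa using (LinearMap.IsIdempotentElem.range_eq_ker_one_sub he'.one_sub).symm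
  have : Module.Projective S (LinearMap.ker (Matrix.toLin' e)) :=
    hker ▸ projective_range he'.one_sub
  have : Module.Finite S (LinearMap.ker (Matrix.toLin' e)) :=
    hker ▸ Module.Finite.range _
  have : Module.Free S (LinearMap.range (Matrix.toLin' e)) := Module.free_of_flat_of_isLocalRing
  have : Module.Free S (LinearMap.ker (Matrix.toLin' e)) := Module.free_of_flat_of_isLocalRing
  have htr := (LinearMap.IsIdempotentElem.isProj_range _ he').trace
  exact ⟨_, (Matrix.trace_toLin'_eq e).symm.trans htr⟩

variable {R : Type u} [CommRing R] {n : ℕ}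

/-- The matrix `diag(a, 0, …, 0)` has trace `a`, and its image over `S` is a sum of idempotents
with natural numbers as traces. -/
theorem exists_map_eq_natCast (hn : 1 ≤ n)
    (h : ∀ M : Matrix (Fin n) (Fin n) R, IsSumOfThreeIdempotents M)
    {S : Type v} [CommRing S] [IsLocalRing S] (φ : R →+* S) (a : R) : ∃ k : ℕ, φ a = k := by
  have : NeZero n := ⟨by omega⟩
  obtain ⟨e, f, g, he, hf, hg, hM⟩ := (h (Matrix.single 0 0 a)).map φ.mapMatrix
  obtain ⟨i, hi⟩ := exists_trace_eq_natCast he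
  obtain ⟨j, hj⟩ := exists_trace_eq_natCast hf
  obtain ⟨k, hk⟩ := exists_trace_eq_natCast hg
  refine ⟨i + j + k, ?_⟩
  have ht := congrArg Matrix.trace hM
  rw [Matrix.trace_add, Matrix.trace_add, hi, hj, hk, RingHom.mapMatrix_apply,
    ← AddMonoidHom.map_trace φ] at ht
  simpa using ht

theorem two_hundred_forty_eq_zero (hn : 1 ≤ n)
    (h : ∀ M : Matrix (Fin n) (Fin n) R, IsSumOfThreeIdempotents M) : (240 : R) = 0 := by
  have : NeZero n := ⟨by omega⟩
  obtain ⟨e, f, g, he, hf, hg, h4⟩ := h 4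
  have h1 := sixty_mul_eq_zero_of_four_eq_add he hf hg h4
  have h2 := sixty_mul_eq_zero_of_four_eq_add hf he hg (h4.trans (by abel))
  have h3 := sixty_mul_eq_zero_of_four_eq_add hg he hf (h4.trans (by abel))
  have h5 : (60 * 4 : Matrix (Fin n) (Fin n) R) = 0 := by
    rw [h4, mul_add, mul_add, h1, h2, h3, add_zero, add_zero]
  have h6 := congrFun (congrFun h5 0) 0
  have h7 : (60 * 4 : Matrix (Fin n) (Fin n) R) = ((240 : ℕ) : Matrix (Fin n) (Fin n) R) := by
    norm_num
  rw [h7, ← Matrix.diagonal_natCast, Matrix.diagonal_apply_eq] at h6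
  simpa using h6

theorem five_ne_zero_of_ringHom (hn : 1 ≤ n)
    (h : ∀ M : Matrix (Fin n) (Fin n) R, IsSumOfThreeIdempotents M)
    {K : Type v} [Field K] (φ : R →+* K) : (5 : K) ≠ 0 := by
  have : NeZero n := ⟨by omega⟩
  intro h5
  obtain hne | hno := Nat.even_or_odd n
  · refine add_ne_four_add_of_even h5 (V := Fin n → K) (by simpa using hne)
      (b := Matrix.toLin' (Matrix.single 0 0 2)) ?_ (by simp) ?_
    · have hs : (Matrix.single 0 0 2 : Matrix (Fin n) (Fin n) K) =
          Matrix.vecMulVec (Pi.single 0 2) (Pi.single 0 1) := by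
        ext i j
        simp [Matrix.single, Matrix.vecMulVec, Pi.single_apply, ite_and, eq_comm]
        split_ifs <;> rfl
      rw [hs, Matrix.toLin'_apply']
      exact Matrix.rank_vecMulVec_le _ _
    · have := (h (4 + Matrix.single 0 0 2)).map
        ((Matrix.toLinAlgEquiv' : Matrix (Fin n) (Fin n) K ≃ₐ[K] _).toRingHom.comp φ.mapMatrix)
      convert this using 1
      rw [map_add, map_ofNat, map_ofNat, RingHom.comp_apply, RingHom.mapMatrix_apply,
        Matrix.map_single, map_ofNat]
      rfl
  · obtain ⟨e, f, g, he, hf, hg, h4⟩ := (h 4).map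
      ((Matrix.toLinAlgEquiv' : Matrix (Fin n) (Fin n) K ≃ₐ[K] _).toRingHom.comp φ.mapMatrix)
    have := even_finrank_of_four_eq_add h5 he hf hg (by rw [← h4, map_ofNat, map_ofNat])
    rw [Module.finrank_fin_fun] at this
    exact Nat.not_even_iff_odd.mpr hno this

theorem ringHom_pow_three_eq (hn : 1 ≤ n)
    (h : ∀ M : Matrix (Fin n) (Fin n) R, IsSumOfThreeIdempotents M)
    {K : Type v} [Field K] (φ : R →+* K) (a : R) : φ (a ^ 3 - a) = 0 := by
  have h5 := five_ne_zero_of_ringHom hn h φ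
  have h240 : (240 : K) = 0 := by
    rw [← map_ofNat φ 240, two_hundred_forty_eq_zero hn h, map_zero]
  have h6 : (6 : K) = 0 := by
    -- `240 = 2 ^ 4 * 3 * 5` divides `5 * 6 ^ 4`.
    have : (5 : K) * 6 ^ 4 = 0 := by linear_combination 27 * h240
    simpa [h5] using this
  obtain ⟨k, hk⟩ := exists_map_eq_natCast hn h φ a
  have hdvd : (6 : ℤ) ∣ (k : ℤ) ^ 3 - k := by
    have key : ∀ z : ZMod 6, z ^ 3 - z = 0 := by decide
    have := (ZMod.intCast_zmod_eq_zero_iff_dvd ((k : ℤ) ^ 3 - k) 6).mp (by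
      push_cast
      exact key _)
    simpa using this
  obtain ⟨m, hm⟩ := hdvd
  have := congrArg (Int.cast : ℤ → K) hm
  push_cast at this
  rw [map_sub, map_pow, hk, this, h6, zero_mul]

theorem isNilpotent_pow_three_sub (hn : 1 ≤ n)
    (h : ∀ M : Matrix (Fin n) (Fin n) R, IsSumOfThreeIdempotents M) (a : R) :
    IsNilpotent (a ^ 3 - a) := by
  rw [nilpotent_iff_mem_prime]
  intro P hP
  rw [← Ideal.algebraMap_residueField_eq_zero]
  exact ringHom_pow_three_eq hn h _ a

/-- Decomposing the scalar matrix `4` over `ℤ/8` gives idempotents killed by `60`. Such an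
idempotent `e` is of the form `2 • y`, so `e = e ^ 3 = 8 • y ^ 3 = 0`. -/
theorem isEmpty_ringHom_zmod_eight (hn : 1 ≤ n)
    (h : ∀ M : Matrix (Fin n) (Fin n) R, IsSumOfThreeIdempotents M) :
    IsEmpty (R →+* ZMod 8) := by
  refine ⟨fun φ => ?_⟩
  have : NeZero n := ⟨by omega⟩
  have h0 : ∀ e : Matrix (Fin n) (Fin n) (ZMod 8), IsIdempotentElem e → 60 * e = 0 → e = 0 := by
    intro e he he0
    have heven : ∀ z : ZMod 8, 60 * z = 0 → z = 2 * (z.val / 2 : ℕ) := by decide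
    have hmul : e = 2 • Matrix.of fun i j => (((e i j).val / 2 : ℕ) : ZMod 8) := by
      ext i j
      have h60 : 60 * e i j = 0 := by
        have h6 := congrFun (congrFun he0 i) j
        have h7 : (60 : Matrix (Fin n) (Fin n) (ZMod 8)) = Matrix.diagonal fun _ => 60 :=
          (Matrix.diagonal_ofNat' 60).symm
        rw [h7, Matrix.diagonal_mul] at h6
        simpa using h6
      simpa using heven _ h60
    have h3 := he.pow_succ_eq 2
    rw [← h3, hmul, smul_pow]
    ext i j
    rw [Matrix.smul_apply, nsmul_eq_mul]
    have : ((2 ^ (2 + 1) : ℕ) : ZMod 8) = 0 := by decide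
    rw [this, zero_mul, Matrix.zero_apply]
  obtain ⟨e, f, g, he, hf, hg, h4⟩ := (h 4).map φ.mapMatrix
  rw [map_ofNat] at h4
  have h1 := h0 e he (sixty_mul_eq_zero_of_four_eq_add he hf hg h4)
  have h2 := h0 f hf (sixty_mul_eq_zero_of_four_eq_add hf he hg (h4.trans (by abel)))
  have h3 := h0 g hg (sixty_mul_eq_zero_of_four_eq_add hg he hf (h4.trans (by abel)))
  rw [h1, h2, h3, add_zero, add_zero] at h4
  have h6 := congrFun (congrFun h4 0) 0
  rw [← Matrix.diagonal_ofNat' 4, Matrix.diagonal_apply_eq, Matrix.zero_apply] at h6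
  change (4 : ZMod 8) = 0 at h6
  revert h6
  decide

/-! ### Indecomposable rings -/

theorem IsIndecomposableRing.eq_zero_or_eq_one (hR : IsIndecomposableRing R) {e : R}
    (he : IsIdempotentElem e) : e = 0 ∨ e = 1 := by
  by_contra! hne
  have h1 : Nontrivial (R ⧸ Ideal.span {e}) := by
    rw [Ideal.Quotient.nontrivial_iff, Ne, Ideal.span_singleton_eq_top]
    exact fun hu => hne.2 ((IsIdempotentElem.iff_eq_one_of_isUnit hu).mp he)
  have h2 : Nontrivial (R ⧸ Ideal.span {1 - e}) := by
    rw [Ideal.Quotient.nontrivial_iff, Ne, Ideal.span_singleton_eq_top]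
    exact fun hu => hne.1 (by
      simpa using (IsIdempotentElem.iff_eq_one_of_isUnit hu).mp he.one_sub)
  refine hR.not_prod (R ⧸ Ideal.span {e}) (R ⧸ Ideal.span {1 - e}) ⟨?_⟩
  exact (AlgEquiv.prodQuotientOfIsIdempotentElem R he he.one_sub (by simp)
    (by simp [mul_sub, he.eq])).toRingEquiv

/-- If `a ^ 3 - a` is nilpotent then `a ^ 2` is idempotent modulo the nilradical. The idempotent
lifting it is `0` or `1`; accordingly `a` is nilpotent or a unit. -/
theorem IsIndecomposableRing.isLocalRing (hR : IsIndecomposableRing R)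
    (h : ∀ a : R, IsNilpotent (a ^ 3 - a)) : IsLocalRing R := by
  have := hR.nontrivial
  refine IsLocalRing.of_isUnit_or_isUnit_one_sub_self fun a => ?_
  have ha : Ideal.Quotient.mk (nilradical R) a ^ 3 = Ideal.Quotient.mk (nilradical R) a := by
    rw [← sub_eq_zero, ← map_pow, ← map_sub, Ideal.Quotient.eq_zero_iff_mem, mem_nilradical]
    exact h a
  obtain ⟨e, he, hea⟩ := exists_isIdempotentElem_eq_of_ker_isNilpotent
    (Ideal.Quotient.mk (nilradical R)) (fun x hx => by rwa [Ideal.mk_ker, mem_nilradical] at hx)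
    (Ideal.Quotient.mk (nilradical R) (a ^ 2)) ⟨_, rfl⟩ (by
      rw [IsIdempotentElem, map_pow]
      linear_combination Ideal.Quotient.mk (nilradical R) a * ha)
  rw [Ideal.Quotient.eq, mem_nilradical] at hea
  obtain rfl | rfl := hR.eq_zero_or_eq_one he
  · rw [zero_sub, isNilpotent_neg_iff, IsNilpotent.pow_iff_pos two_ne_zero] at hea
    exact Or.inr hea.isUnit_one_sub
  · have := hea.isUnit_one_sub
    rw [sub_sub_cancel, isUnit_pow_iff two_ne_zero] at this
    exact Or.inl this

theorem eq_two_or_three_or_four {m : ℕ} (h240 : m ∣ 240) (h5 : ¬ 5 ∣ m) (h8 : ¬ 8 ∣ m)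
    (h23 : ¬ (2 ∣ m ∧ 3 ∣ m)) (h1 : m ≠ 1) : m = 2 ∨ m = 3 ∨ m = 4 := by
  have hco : Nat.Coprime m 5 := ((Nat.Prime.coprime_iff_not_dvd (by norm_num)).mpr h5).symm
  have h48 : m ∣ 48 := hco.dvd_of_dvd_mul_right (by simpa using h240)
  have hle := Nat.le_of_dvd (by norm_num) h48
  interval_cases m <;> omega

theorem not_isUnit_natCast_of_dvd_ringChar [Nontrivial R] (hm : ringChar R ≠ 0) {p : ℕ}
    (hp : 1 < p) (h : p ∣ ringChar R) : ¬ IsUnit (p : R) := by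
  obtain ⟨t, ht⟩ := h
  intro hu
  have h0 : (p : R) * t = 0 := by
    rw [← Nat.cast_mul, ← ht, ringChar.Nat.cast_ringChar]
  rw [hu.mul_right_eq_zero, ringChar.spec] at h0
  have htpos : 0 < t := Nat.pos_of_ne_zero (by rintro rfl; simp [ht] at hm)
  have := Nat.le_of_dvd htpos h0
  nlinarith

/-- By `exists_map_eq_natCast` the ring is `ℤ/m` with `m` its characteristic. Here `m` divides `240`,
`8` does not divide `m`, `5` does not since `6 = 2 ^ 3 - 2` is nilpotent, and `2` and `3` do not
both divide `m` since the ring is local. -/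
theorem ringEquiv_zmod_of_isLocalRing [IsLocalRing R] (hn : 1 ≤ n)
    (h : ∀ M : Matrix (Fin n) (Fin n) R, IsSumOfThreeIdempotents M) :
    Nonempty (R ≃+* ZMod 2) ∨ Nonempty (R ≃+* ZMod 3) ∨ Nonempty (R ≃+* ZMod 4) := by
  have hbij : Function.Bijective (ZMod.castHom (dvd_refl (ringChar R)) R) := by
    refine ⟨ZMod.castHom_injective R, fun a => ?_⟩
    obtain ⟨k, hk⟩ := exists_map_eq_natCast hn h (RingHom.id R) a
    exact ⟨k, by rw [map_natCast, ← hk, RingHom.id_apply]⟩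
  have E : R ≃+* ZMod (ringChar R) := (RingEquiv.ofBijective _ hbij).symm
  have h240 : ringChar R ∣ 240 := by
    rw [← ringChar.spec]
    simpa using two_hundred_forty_eq_zero hn h
  have h5 : ¬ 5 ∣ ringChar R := by
    intro h5
    obtain ⟨k, hk⟩ := isNilpotent_pow_three_sub hn h (2 : R)
    have h6 : ((6 ^ k : ℕ) : R) = 0 := by
      push_cast
      rw [← hk]
      norm_num
    rw [ringChar.spec] at h6
    have := (by norm_num : Nat.Prime 5).dvd_of_dvd_pow (h5.trans h6)
    omega
  have h8 : ¬ 8 ∣ ringChar R := fun h8 =>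
    (isEmpty_ringHom_zmod_eight hn h).false ((ZMod.castHom h8 (ZMod 8)).comp E.toRingHom)
  have h0 : ringChar R ≠ 0 := fun h0 => by
    rw [h0] at h240
    omega
  have h23 : ¬ (2 ∣ ringChar R ∧ 3 ∣ ringChar R) := by
    rintro ⟨h2, h3⟩
    have n2 := not_isUnit_natCast_of_dvd_ringChar h0 (by norm_num) h2
    have n3 := not_isUnit_natCast_of_dvd_ringChar h0 (by norm_num) h3
    obtain hu | hu := IsLocalRing.isUnit_or_isUnit_of_add_one
      (show ((3 : ℕ) : R) + -((2 : ℕ) : R) = 1 by push_cast; norm_num)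
    · exact n3 hu
    · exact n2 (by simpa using hu)
  have h1 : ringChar R ≠ 1 := CharP.ringChar_ne_one
  obtain hm | hm | hm := eq_two_or_three_or_four h240 h5 h8 h23 h1 <;> rw [hm] at E
  · exact Or.inl ⟨E⟩
  · exact Or.inr (Or.inl ⟨E⟩)
  · exact Or.inr (Or.inr ⟨E⟩)

end Image

theorem theorem3p2 {R : Type u} [CommRing R] {n : ℕ} (hn : 1 ≤ n)
    (h : ∀ M : Matrix (Fin n) (Fin n) R, IsSumOfThreeIdempotents M) :
    (∀ x ∈ Ring.jacobson R, IsNilpotent x) ∧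
    (∀ x : R ⧸ Ring.jacobson R, x ^ 3 = x) ∧
    (IsIndecomposableRing R →
      Nonempty (R ≃+* ZMod 2) ∨ Nonempty (R ≃+* ZMod 3) ∨ Nonempty (R ≃+* ZMod 4)) := by
  refine ⟨fun x hx => ?_, fun x => ?_, fun hR => ?_⟩
  · rw [nilpotent_iff_mem_prime]
    intro P hP
    obtain ⟨m, hm, hPm⟩ := Ideal.exists_le_maximal P hP.ne_top
    have hxm : x ∈ m := Ring.jacobson_le_of_isMaximal m hx
    have hP3 := nilpotent_iff_mem_prime.mp (isNilpotent_pow_three_sub hn h x) P hP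
    rw [show x ^ 3 - x = x * (x * x - 1) by ring] at hP3
    refine (hP.mem_or_mem hP3).resolve_right fun h1 => hm.ne_top ?_
    rw [Ideal.eq_top_iff_one, ← Ideal.neg_mem_iff]
    simpa using m.sub_mem (hPm h1) (m.mul_mem_left x hxm)
  · obtain ⟨a, rfl⟩ := Ideal.Quotient.mk_surjective x
    rw [← sub_eq_zero, ← map_pow, ← map_sub, Ideal.Quotient.eq_zero_iff_mem,
      Ring.jacobson_eq_sInf_isMaximal, Submodule.mem_sInf]
    exact fun m (hm : Ideal.IsMaximal m) =>
      nilpotent_iff_mem_prime.mp (isNilpotent_pow_three_sub hn h a) m hm.isPrime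
  · have := hR.isLocalRing (isNilpotent_pow_three_sub hn h)
    exact ringEquiv_zmod_of_isLocalRing hn h
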